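/- For integers $k\ge 0$ and $n\ge 1$ let $S_k(n)=\sum_{j=1}^{n} j^k$. The asymptotic density of a set $A$ of positive integers is $\delta(A)=\lim_{N\to\infty}\frac{1}{N}\#(A\cap\{1,\dots,N\})$, if this limit exists. Let $\mathfrak{P}$ be the set of odd positive integers $n$ with $S_{(n-1)/2}(n)\equiv 0 \pmod n$. Call a positive integer $n$ an anti-Korselt number if $p-1\nmid n-1$ for every prime divisor $p$ of $n$, and let $\mathfrak{K}$ be the set of anti-Korselt numbers. Proposition (density of anti-Korselt numbers). One has $\mathfrak{K}=\{n\ge 1 : n\mid S_{n-1}(n)\}\setminus 4\mathbb{N}$. Moreover, the sets $\mathfrak{P}$ and $\mathfrak{K}$ both have an asymptotic density, and $$\delta(\mathfrak{K})=2\delta(\mathfrak{P})-\tfrac12\in[0.25801,\,0.259652].$$ -/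

import Mathlib

/-- `A` has asymptotic density `d`: `#(A ∩ {1, …, N}) / N → d` as `N → ∞`. -/
def HasAsymptoticDensity (A : Set ℕ) (d : ℝ) : Prop :=
  Filter.Tendsto (fun N : ℕ => ((A ∩ Set.Icc 1 N).ncard : ℝ) / (N : ℝ)) Filter.atTop (nhds d)

/-- The power sum `1 ^ k + 2 ^ k + ⋯ + n ^ k`. -/
def powerSum (k n : ℕ) : ℕ := ∑ j ∈ Finset.Icc 1 n, j ^ k

/-- The positive integers `n` that divide `1 ^ f n + ⋯ + n ^ f n`. -/
def powerSumDivisors (f : ℕ → ℕ) : Set ℕ := {n | 0 < n ∧ n ∣ powerSum (f n) n}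

/-- The odd positive integers `n` that divide `1 ^ ((n - 1) / 2) + ⋯ + n ^ ((n - 1) / 2)`. -/
def oddHalfPowerSumDivisors : Set ℕ := {n | Odd n ∧ n ∣ powerSum ((n - 1) / 2) n}

/-- `n` is a positive integer such that `p - 1 ∤ n - 1` for every prime divisor `p` of `n`. -/
def IsAntiKorselt (n : ℕ) : Prop :=
  0 < n ∧ ∀ p : ℕ, p.Prime → p ∣ n → ¬ (p - 1) ∣ (n - 1)

/-! For odd `n` and `k ≠ 0`, cutting `{1, …, n}` into blocks of length `p ^ (a + 1)` and then `p`
shows that `n ∣ powerSum k n` iff `p - 1 ∤ k` for all primes `p ∣ n` (`dvd_powerSum_iff`). Hence the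
two sets are `oddSifted s`, with `s = 1` for the anti-Korselt numbers and `s = 2` for the half
exponent: the odd `n` that avoid the progressions `n ≡ 1 [MOD s * (p - 1)]`, `p ∣ n`.

Sieving by the primes `p ≤ k` only leaves a set whose density is a finite inclusion-exclusion sum.
The larger primes cost at most `∑ 1 / (p * (p - 1))` plus a term `π(N) / N → 0`, so the densities
converge (`exists_of_approx`).

Both sums are `sieveDensity l L 1 / s` with `s * L = 2`. Since `p - 1` is even, replacing `L = 1` by
`L = 2` changes only the leading term, from `1` to `1 / 2`; this is the relation between the
densities. The numerical bounds come from `k = 250`, in integer arithmetic with controlled rounding.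
-/

/-! ### Divisibility of power sums -/

theorem powerSum_eq_sum_range (k n : ℕ) :
    powerSum k n = ∑ j ∈ Finset.range n, (j + 1) ^ k := by
  rw [powerSum, Finset.range_eq_Ico, Finset.sum_Ico_add' (fun j => j ^ k) 0 n 1]
  rfl

/-- Splitting `{1, …, r * M}` into `r` blocks of length `M`, in a ring where `M ^ 2 = 0`. -/
theorem cast_powerSum_mul {R : Type*} [CommRing R] (k M : ℕ) (hM : (M : R) ^ 2 = 0) (r : ℕ) :
    (powerSum k (r * M) : R) = r * powerSum k M +
      M * (∑ i ∈ Finset.range r, i : ℕ) *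
        (k * ∑ j ∈ Finset.range M, ((j : R) + 1) ^ (k - 1)) := by
  simp only [powerSum_eq_sum_range, Nat.cast_sum, Nat.cast_pow, Nat.cast_add, Nat.cast_one]
  induction r with
  | zero => simp
  | succ r ih =>
    rw [Nat.succ_mul, Finset.sum_range_add, ih, Finset.sum_range_succ _ r]
    have h : ∀ j : ℕ, (((r * M + j : ℕ) : R) + 1) ^ k =
        ((j : R) + 1) ^ k + (M * r) * (k * ((j : R) + 1) ^ (k - 1)) := by
      intro j
      obtain ⟨c, hc⟩ := Polynomial.powAddExpansion ((j : R) + 1) (r * M) k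
      have e : (((r * M + j : ℕ) : R) + 1) = ((j : R) + 1) + r * M := by push_cast; ring
      -- The binomial expansion stops at first order because `M ^ 2 = 0`.
      rw [e, hc, mul_pow, hM]
      ring
    simp only [h, Finset.sum_add_distrib, ← Finset.mul_sum]
    push_cast
    ring

theorem sum_range_id_eq_mul_of_odd {p : ℕ} (hp : Odd p) :
    ∑ i ∈ Finset.range p, i = p * ((p - 1) / 2) := by
  obtain ⟨c, rfl⟩ := hp
  have := Finset.sum_range_id_mul_two (2 * c + 1)
  have e : (2 * c + 1 - 1) / 2 = c := by omega
  rw [e]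
  rw [show 2 * c + 1 - 1 = c * 2 by omega, ← mul_assoc] at this
  exact Nat.eq_of_mul_eq_mul_right two_pos this

/-- Passing from `p ^ (a + 1)` to `p ^ (a + 2)` multiplies the sum by `p`: the first-order term
carries `0 + ⋯ + (p - 1)`, a multiple of `p` because `p` is odd. -/
theorem powerSum_prime_pow_modEq {p : ℕ} (hp : Odd p) (k a : ℕ) :
    powerSum k (p ^ (a + 1)) ≡ p ^ a * powerSum k p [MOD p ^ (a + 1)] := by
  induction a with
  | zero => simp [Nat.ModEq.refl]
  | succ a ih =>
    have h1 : powerSum k (p * p ^ (a + 1)) ≡ p * powerSum k (p ^ (a + 1)) [MOD p ^ (a + 2)] := by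
      rw [← ZMod.natCast_eq_natCast_iff]
      have hM : ((p ^ (a + 1) : ℕ) : ZMod (p ^ (a + 2))) ^ 2 = 0 := by
        rw [← Nat.cast_pow, ZMod.natCast_eq_zero_iff, ← pow_mul]
        exact pow_dvd_pow _ (by omega)
      have h0 : ((p ^ (a + 1) : ℕ) : ZMod (p ^ (a + 2))) * (p * ((p - 1) / 2) : ℕ) = 0 := by
        rw [← Nat.cast_mul, ← mul_assoc, ← pow_succ, Nat.cast_mul, ZMod.natCast_self, zero_mul]
      rw [cast_powerSum_mul k _ hM, sum_range_id_eq_mul_of_odd hp, h0]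
      simp
    have h2 := ih.mul_left' p
    rw [← pow_succ'] at h1 h2
    refine h1.trans (h2.trans ?_)
    rw [← mul_assoc, ← pow_succ']

theorem powerSum_mul_modEq (k M m : ℕ) : powerSum k (m * M) ≡ m * powerSum k M [MOD M] := by
  rw [← ZMod.natCast_eq_natCast_iff, cast_powerSum_mul k M (by simp)]
  simp

theorem ZMod.sum_range_cast {p : ℕ} [NeZero p] {β : Type*} [AddCommMonoid β] (f : ZMod p → β) :
    ∑ j ∈ Finset.range p, f j = ∑ x, f x := by
  refine Finset.sum_bij (fun j _ => (j : ZMod p)) (fun _ _ => Finset.mem_univ _) ?_ ?_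
    (fun _ _ => rfl)
  · intro i hi j hj h
    rw [ZMod.natCast_eq_natCast_iff'] at h
    rwa [Nat.mod_eq_of_lt (Finset.mem_range.1 hi), Nat.mod_eq_of_lt (Finset.mem_range.1 hj)] at h
  · intro x _
    exact ⟨x.val, Finset.mem_range.2 x.val_lt, by simp⟩

/-- Modulo `p` this is the sum of `x ^ k` over the field, which is `-1` if `p - 1 ∣ k` and `0`
otherwise; `k ≠ 0` discards `x = 0`. -/
theorem prime_dvd_powerSum_iff {p : ℕ} (hp : p.Prime) {k : ℕ} (hk : k ≠ 0) :
    p ∣ powerSum k p ↔ ¬ (p - 1) ∣ k := by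
  have := Fact.mk hp
  rw [← ZMod.natCast_eq_zero_iff]
  have h1 : (powerSum k p : ZMod p) = ∑ x : ZMod p, x ^ k := by
    rw [powerSum_eq_sum_range]
    push_cast
    rw [ZMod.sum_range_cast (fun x : ZMod p => (x + 1) ^ k)]
    exact Equiv.sum_comp (Equiv.addRight (1 : ZMod p)) (fun x => x ^ k)
  have h2 : ∑ x : ZMod p, x ^ k = ∑ x : (ZMod p)ˣ, (x ^ k : ZMod p) := by
    classical
    symm
    refine Finset.sum_of_injOn (fun x : (ZMod p)ˣ => (x : ZMod p))
      Units.val_injective.injOn (by simp) ?_ (fun _ _ => rfl)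
    intro x _ hx
    have : x = 0 := by
      by_contra h
      exact hx ⟨Units.mk0 x h, by simp, rfl⟩
    simp [this, hk]
  rw [h1, h2, FiniteField.sum_pow_units, ZMod.card]
  split_ifs with h <;> simp [h]

theorem dvd_powerSum_iff {n k : ℕ} (hn : Odd n) (hk : k ≠ 0) :
    n ∣ powerSum k n ↔ ∀ p : ℕ, p.Prime → p ∣ n → ¬ (p - 1) ∣ k := by
  have n0 : n ≠ 0 := by rintro rfl; simp at hn
  have key : ∀ p : ℕ, p.Prime → ∀ a m : ℕ, n = m * p ^ (a + 1) →
      powerSum k n ≡ p ^ a * (m * powerSum k p) [MOD p ^ (a + 1)] := by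
    intro p hp a m e
    have hpo : Odd p := by
      rw [e, pow_succ, ← mul_assoc] at hn
      exact Nat.Odd.of_mul_right hn
    have h1 := powerSum_mul_modEq k (p ^ (a + 1)) m
    rw [← e] at h1
    refine h1.trans ((Nat.ModEq.mul_left m (powerSum_prime_pow_modEq hpo k a)).trans ?_)
    rw [mul_left_comm]
  constructor
  · intro h p hp hpn
    -- The full power of `p` is split off, so that `p ∤ m` and `m` can be cancelled.
    obtain ⟨a, m, hm, e⟩ := Nat.exists_eq_pow_mul_and_not_dvd n0 p hp.ne_one
    obtain ⟨a, rfl⟩ : ∃ b, a = b + 1 := by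
      refine Nat.exists_eq_succ_of_ne_zero ?_
      rintro rfl
      rw [pow_zero, one_mul] at e
      exact hm (e ▸ hpn)
    rw [mul_comm] at e
    have h1 : p ^ (a + 1) ∣ p ^ a * (m * powerSum k p) :=
      ((key p hp a m e).dvd_iff dvd_rfl).1 (dvd_trans (e ▸ dvd_mul_left _ _) h)
    rw [pow_succ, Nat.mul_dvd_mul_iff_left (pow_pos hp.pos a)] at h1
    exact (prime_dvd_powerSum_iff hp hk).1 ((hp.dvd_mul.1 h1).resolve_left hm)
  · intro h
    rw [Nat.dvd_iff_prime_pow_dvd_dvd]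
    rintro p (_ | a) hp ⟨m, e⟩
    · simp
    · refine ((key p hp a m (e.trans (mul_comm _ _))).dvd_iff dvd_rfl).2 ?_
      rw [pow_succ]
      refine mul_dvd_mul_left _ (Dvd.dvd.mul_left ?_ m)
      refine (prime_dvd_powerSum_iff hp hk).2 (h p hp ?_)
      rw [e, pow_succ, mul_assoc]
      exact (dvd_mul_right p m).mul_left _

theorem odd_powerSum_of_mod_four_eq_two {n k : ℕ} (hn : n % 4 = 2) (hk : k ≠ 0) :
    Odd (powerSum k n) := by
  obtain ⟨m, rfl⟩ : ∃ m, n = m * 2 := ⟨n / 2, by omega⟩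
  have hm : Odd m := by rw [Nat.odd_iff]; omega
  have h := powerSum_mul_modEq k 2 m
  have h2 : powerSum k 2 = 1 + 2 ^ k := by
    rw [powerSum_eq_sum_range]; simp [Finset.sum_range_succ]
  have h3 : Odd (m * powerSum k 2) := by
    rw [h2]
    refine hm.mul ?_
    rw [Nat.odd_add]
    simp [Nat.even_pow, hk]
  rw [Nat.odd_iff] at h3 ⊢
  rw [← h3]
  exact h

theorem IsAntiKorselt.odd {n : ℕ} (h : IsAntiKorselt n) : Odd n := by
  by_contra hn
  exact h.2 2 Nat.prime_two (Nat.not_odd_iff_even.1 hn).two_dvd (by simp)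

theorem setOf_isAntiKorselt_eq :
    {n : ℕ | IsAntiKorselt n} = powerSumDivisors (fun n => n - 1) \ {n : ℕ | 4 ∣ n} := by
  ext n
  simp only [Set.mem_ofPred_eq, Set.mem_sdiff, powerSumDivisors]
  rcases Nat.even_or_odd n with he | ho
  · refine iff_of_false (fun h => (Nat.not_odd_iff_even.2 he) h.odd) ?_
    rintro ⟨⟨hn, hd⟩, h4⟩
    have h2 := he.two_dvd
    have := odd_powerSum_of_mod_four_eq_two (n := n) (k := n - 1) (by omega) (by omega)
    exact (Nat.not_even_iff_odd.2 this) (even_iff_two_dvd.2 (h2.trans hd))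
  · have h4 : ¬ 4 ∣ n := by rw [Nat.odd_iff] at ho; omega
    -- The exponent vanishes only for `n = 1`, which the criterion does not cover.
    rcases eq_or_ne (n - 1) 0 with h1 | h1
    · obtain rfl : n = 1 := by have := ho.pos; omega
      simp only [IsAntiKorselt, h4, not_false_eq_true, and_true]
      refine iff_of_true ⟨one_pos, fun p hp hd => ?_⟩ (by simp)
      exact absurd (Nat.dvd_one.1 hd) hp.ne_one
    · rw [dvd_powerSum_iff ho h1]
      simp [IsAntiKorselt, h4]

theorem mem_oddHalfPowerSumDivisors_iff {n : ℕ} :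
    n ∈ oddHalfPowerSumDivisors ↔
      Odd n ∧ ∀ p : ℕ, p.Prime → p ∣ n → ¬ 2 * (p - 1) ∣ n - 1 := by
  refine and_congr_right fun ho => ?_
  obtain ⟨m, rfl⟩ := ho
  have e : (2 * m + 1 - 1) / 2 = m := by omega
  rw [e]
  rcases eq_or_ne m 0 with rfl | hm
  · refine iff_of_true (by simp) fun p hp hd => ?_
    exact absurd (Nat.dvd_one.1 hd) hp.ne_one
  · rw [dvd_powerSum_iff ⟨m, rfl⟩ hm]
    simp [Nat.mul_dvd_mul_iff_left]

/-! ### Basic properties of asymptotic density -/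

namespace HasAsymptoticDensity

open Filter Topology

theorem of_abs_sub_le {A : Set ℕ} {d C : ℝ}
    (h : ∀ N : ℕ, |((A ∩ Set.Icc 1 N).ncard : ℝ) - N * d| ≤ C) : HasAsymptoticDensity A d := by
  rw [HasAsymptoticDensity, tendsto_iff_norm_sub_tendsto_zero]
  refine squeeze_zero' (Eventually.of_forall fun _ => norm_nonneg _) ?_
    (tendsto_const_div_atTop_nhds_zero_nat C)
  filter_upwards [eventually_gt_atTop 0] with N hN
  have hN' : (0 : ℝ) < N := by exact_mod_cast hN
  rw [Real.norm_eq_abs, le_div_iff₀ hN', ← abs_of_pos hN', ← abs_mul, abs_of_pos hN', sub_mul,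
    div_mul_cancel₀ _ hN'.ne', mul_comm d]
  exact h N

theorem empty : HasAsymptoticDensity ∅ 0 := by simp [HasAsymptoticDensity]

theorem sdiff {A B : Set ℕ} {a b : ℝ} (hA : HasAsymptoticDensity A a)
    (hB : HasAsymptoticDensity B b) (h : B ⊆ A) : HasAsymptoticDensity (A \ B) (a - b) := by
  refine (Tendsto.sub hA hB).congr fun N => ?_
  have e := Set.ncard_sdiff_add_ncard_of_subset (Set.inter_subset_inter_left (Set.Icc 1 N) h)
  rw [← Set.inter_sdiff_distrib_right] at e
  rw [← e, ← sub_div]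
  push_cast
  ring

theorem mono {A B : Set ℕ} {a b : ℝ} (hA : HasAsymptoticDensity A a)
    (hB : HasAsymptoticDensity B b) (h : A ⊆ B) : a ≤ b := by
  refine le_of_tendsto_of_tendsto' hA hB fun N => ?_
  gcongr
  exact Set.toFinite _

theorem nonneg {A : Set ℕ} {a : ℝ} (hA : HasAsymptoticDensity A a) : 0 ≤ a :=
  ge_of_tendsto' hA fun _ => by positivity

theorem setOf_modEq (a : ℕ) {m : ℕ} (hm : 0 < m) :
    HasAsymptoticDensity {n | n ≡ a [MOD m]} (1 / m) := by
  -- The count is a difference of two floors, and two fractional parts differ by less than 1.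
  refine of_abs_sub_le (C := 1) fun N => ?_
  have e : {n | n ≡ a [MOD m]} ∩ Set.Icc 1 N = ({x ∈ Finset.Ioc 0 N | x ≡ a [MOD m]} : Finset ℕ) := by
    ext x
    simp [Nat.succ_le_iff, and_comm]
  rw [e, Set.ncard_coe_finset]
  have h := Nat.Ioc_filter_modEq_card 0 N hm a
  have h' : (({x ∈ Finset.Ioc 0 N | x ≡ a [MOD m]}.card : ℤ) : ℝ) = _ := congrArg _ h
  rw [max_eq_left] at h'
  · push_cast at h'
    rw [h']
    have h1 := Int.floor_le (((N : ℚ) - a) / m)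
    have h2 := Int.lt_floor_add_one (((N : ℚ) - a) / m)
    have h3 := Int.floor_le (((0 : ℚ) - a) / m)
    have h4 := Int.lt_floor_add_one (((0 : ℚ) - a) / m)
    have e : (N : ℚ) * (1 / m) = (N - a) / m - (0 - a) / m := by ring
    have : |(⌊((N : ℚ) - a) / m⌋ : ℚ) - ⌊((0 : ℚ) - a) / m⌋ - N * (1 / m)| ≤ 1 := by
      rw [e, abs_le]; constructor <;> linarith
    generalize ⌊((N : ℚ) - a) / m⌋ = u at this ⊢
    generalize ⌊((0 : ℚ) - a) / m⌋ = v at this ⊢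
    have h5 : ((|(u : ℚ) - v - N * (1 / m)| : ℚ) : ℝ) ≤ ((1 : ℚ) : ℝ) := Rat.cast_le.2 this
    push_cast at h5
    exact h5
  · rw [sub_nonneg]
    refine Int.floor_le_floor ?_
    gcongr
    simp

end HasAsymptoticDensity

/-! ### Finite sieve by inclusion-exclusion -/

/-- The `n ≡ 1` modulo `L` that are divisible by `Q`. -/
def unitProgression (L Q : ℕ) : Set ℕ := {n | n ≡ 1 [MOD L] ∧ Q ∣ n}

theorem unitProgression_inter (L Q L' Q' : ℕ) :
    unitProgression L Q ∩ unitProgression L' Q' = unitProgression (L.lcm L') (Q.lcm Q') := by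
  ext n
  simp only [unitProgression, Set.mem_inter_iff, Set.mem_ofPred_eq, Nat.lcm_dvd_iff]
  constructor
  · rintro ⟨⟨a, b⟩, c, d⟩
    exact ⟨Nat.mod_lcm a c, b, d⟩
  · rintro ⟨a, b, d⟩
    exact ⟨⟨a.of_dvd (Nat.dvd_lcm_left _ _), b⟩, a.of_dvd (Nat.dvd_lcm_right _ _), d⟩

theorem hasAsymptoticDensity_unitProgression {L Q : ℕ} (hL : 0 < L) (hQ : 0 < Q) :
    HasAsymptoticDensity (unitProgression L Q)
      (if L.Coprime Q then 1 / ((L : ℝ) * Q) else 0) := by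
  split_ifs with h
  · have := HasAsymptoticDensity.setOf_modEq (Nat.chineseRemainder h 1 0) (Nat.mul_pos hL hQ)
    rw [Nat.cast_mul] at this
    convert this using 1
    ext n
    have hx := (Nat.chineseRemainder h 1 0).2
    rw [unitProgression, Set.mem_ofPred_eq, Set.mem_ofPred_eq, ← Nat.modEq_and_modEq_iff_modEq_mul h,
      ← Nat.modEq_zero_iff_dvd]
    exact and_congr ⟨fun a => a.trans hx.1.symm, fun a => a.trans hx.1⟩
      ⟨fun a => a.trans hx.2.symm, fun a => a.trans hx.2⟩
  · have : unitProgression L Q = ∅ := by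
      rw [Set.eq_empty_iff_forall_notMem]
      rintro n ⟨h1, h2⟩
      refine h (Nat.Coprime.symm (Nat.Coprime.coprime_dvd_left h2 ?_))
      rw [Nat.Coprime, h1.gcd_eq, Nat.gcd_one_left]
    rw [this]
    exact .empty

/-- The density of the `n ∈ unitProgression L Q` that lie in no `unitProgression (p - 1) p`
with `p ∈ l`, by inclusion-exclusion. -/
noncomputable def sieveDensity : List ℕ → ℕ → ℕ → ℝ
  | [], L, Q => if L.Coprime Q then 1 / ((L : ℝ) * Q) else 0
  | p :: l, L, Q => sieveDensity l L Q - sieveDensity l (L.lcm (p - 1)) (Q.lcm p)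

theorem hasAsymptoticDensity_sieve {s : ℕ} (hs : 0 < s) (l : List ℕ)
    (hl : ∀ p ∈ l, 1 < p ∧ s.Coprime p) {L Q : ℕ} (hL : 0 < L) (hQ : 0 < Q) (hsQ : s.Coprime Q) :
    HasAsymptoticDensity
      (unitProgression (s * L) Q \ {n | ∃ p ∈ l, n ∈ unitProgression (s * (p - 1)) p})
      (sieveDensity l L Q / s) := by
  induction l generalizing L Q with
  | nil =>
    have h := hasAsymptoticDensity_unitProgression (Nat.mul_pos hs hL) hQ
    have e : (s * L).Coprime Q ↔ L.Coprime Q := by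
      rw [Nat.coprime_mul_iff_left, and_iff_right hsQ]
    simp only [e] at h
    convert h using 1
    · simp
    · rw [sieveDensity]
      split_ifs
      · rw [Nat.cast_mul, div_div, mul_comm (s : ℝ) L, mul_right_comm]
      · simp
  | cons p l ih =>
    obtain ⟨hp, hsp⟩ := hl p (by simp)
    have hl' : ∀ q ∈ l, 1 < q ∧ s.Coprime q := fun q hq => hl q (by simp [hq])
    have h1 := ih hl' hL hQ hsQ
    have h2 := ih hl' (L := L.lcm (p - 1)) (Q := Q.lcm p) (Nat.lcm_pos hL (by omega))
      (Nat.lcm_pos hQ (by omega)) ((hsQ.mul_right hsp).coprime_dvd_right (Nat.lcm_dvd_mul Q p))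
    -- The subtracted term is the sieve of the intersection with the progression of `p`.
    rw [← Nat.lcm_mul_left, ← unitProgression_inter] at h2
    have h3 := h1.sdiff h2 (Set.sdiff_subset_sdiff_left Set.inter_subset_left)
    rw [← sub_div] at h3
    rw [sieveDensity]
    convert h3 using 1
    ext n
    simp only [Set.mem_sdiff, Set.mem_ofPred_eq, Set.mem_inter_iff, List.mem_cons,
      exists_eq_or_imp]
    generalize (∃ q ∈ l, n ∈ unitProgression (s * (q - 1)) q) = X
    tauto

/-- With `s = 1` the alternating sum is the density of an actual set, which gives its sign here and
its trivial upper bound in `sieveDensity_le`. -/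
theorem sieveDensity_nonneg {l : List ℕ} (hl : ∀ p ∈ l, 1 < p) {L Q : ℕ} (hL : 0 < L)
    (hQ : 0 < Q) : 0 ≤ sieveDensity l L Q := by
  have h := hasAsymptoticDensity_sieve one_pos l (fun p hp => ⟨hl p hp, Nat.coprime_one_left p⟩)
    hL hQ (Nat.coprime_one_left Q)
  rw [Nat.cast_one, div_one] at h
  exact h.nonneg

theorem sieveDensity_le {l : List ℕ} (hl : ∀ p ∈ l, 1 < p) {L Q : ℕ} (hL : 0 < L)
    (hQ : 0 < Q) :
    sieveDensity l L Q ≤ if L.Coprime Q then 1 / ((L : ℝ) * Q) else 0 := by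
  have h := hasAsymptoticDensity_sieve one_pos l (fun p hp => ⟨hl p hp, Nat.coprime_one_left p⟩)
    hL hQ (Nat.coprime_one_left Q)
  rw [Nat.cast_one, div_one, one_mul] at h
  exact h.mono (hasAsymptoticDensity_unitProgression hL hQ) Set.sdiff_subset

theorem sieveDensity_two_one {l : List ℕ} (hl : ∀ p ∈ l, Odd p) :
    sieveDensity l 2 1 = sieveDensity l 1 1 - 1 / 2 := by
  induction l with
  | nil => norm_num [sieveDensity]
  | cons p l ih =>
    have h : Nat.lcm 2 (p - 1) = Nat.lcm 1 (p - 1) := by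
      obtain ⟨c, rfl⟩ := hl p (by simp)
      rw [Nat.lcm_one_left, Nat.add_sub_cancel]
      exact Nat.lcm_eq_right (dvd_mul_right 2 c)
    rw [sieveDensity, sieveDensity, h, ih fun q hq => hl q (by simp [hq])]
    ring

/-! ### Density as a limit of outer approximations -/

namespace HasAsymptoticDensity

open Filter Topology

theorem sub_le {A B : Set ℕ} {a b T : ℝ} {g : ℕ → ℝ} (hA : HasAsymptoticDensity A a)
    (hB : HasAsymptoticDensity B b) (h : A ⊆ B) (hg : Tendsto g atTop (𝓝 0))
    (hT : ∀ N, (((B \ A) ∩ Set.Icc 1 N).ncard : ℝ) / N ≤ T + g N) : b - T ≤ a := by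
  have h1 := le_of_tendsto_of_tendsto' (hB.sdiff hA h) (tendsto_const_nhds.add hg) hT
  linarith

/-- A set approximated from outside by sets with a density has a density. -/
theorem exists_of_approx {A : Set ℕ} {B : ℕ → Set ℕ} {d T : ℕ → ℝ} {g : ℕ → ℝ}
    (hB : ∀ k, HasAsymptoticDensity (B k) (d k)) (h : ∀ k, A ⊆ B k)
    (hg : Tendsto g atTop (𝓝 0)) (hT : Tendsto T atTop (𝓝 0))
    (hBA : ∀ k N, (((B k \ A) ∩ Set.Icc 1 N).ncard : ℝ) / N ≤ T k + g N) :
    ∃ D, HasAsymptoticDensity A D ∧ Tendsto d atTop (𝓝 D) := by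
  have hlow : ∀ k N, ((B k ∩ Set.Icc 1 N).ncard : ℝ) / N - T k - g N ≤
      ((A ∩ Set.Icc 1 N).ncard : ℝ) / N := by
    intro k N
    have e := Set.ncard_sdiff_add_ncard_of_subset (Set.inter_subset_inter_left (Set.Icc 1 N) (h k))
    rw [← Set.inter_sdiff_distrib_right] at e
    have := hBA k N
    rw [← e, Nat.cast_add, add_div]
    linarith
  have hup : ∀ k N, ((A ∩ Set.Icc 1 N).ncard : ℝ) / N ≤ ((B k ∩ Set.Icc 1 N).ncard : ℝ) / N := by
    intro k N
    gcongr
    · exact Set.toFinite _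
    · exact h k
  have hlow' : ∀ k, Tendsto (fun N : ℕ => ((B k ∩ Set.Icc 1 N).ncard : ℝ) / N - T k - g N) atTop
      (𝓝 (d k - T k)) := fun k => by
    simpa using (Tendsto.sub (hB k) (tendsto_const_nhds (x := T k))).sub hg
  have hjk : ∀ j k, d j - T j ≤ d k := fun j k =>
    le_of_tendsto_of_tendsto' (hlow' j) (hB k) fun N => (hlow j N).trans (hup k N)
  have hbdd : BddBelow (Set.range d) := ⟨d 0 - T 0, by rintro _ ⟨k, rfl⟩; exact hjk 0 k⟩
  have h1 : ∀ j, d j - T j ≤ ⨅ k, d k := fun j => le_ciInf (hjk j)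
  have h2 : ∀ j, ⨅ k, d k ≤ d j := fun j => ciInf_le hbdd j
  -- The limit is the infimum, as `d j - T j ≤ inf d ≤ d j` for every `j`.
  have hd : Tendsto d atTop (𝓝 (⨅ k, d k)) := by
    refine tendsto_of_tendsto_of_tendsto_of_le_of_le (tendsto_const_nhds (x := ⨅ k, d k))
      (by simpa using hT.const_add (⨅ k, d k)) h2 fun j => ?_
    have := h1 j
    show d j ≤ _ + T j
    linarith
  refine ⟨_, ?_, hd⟩
  refine tendsto_order.2 ⟨fun c hc => ?_, fun c hc => ?_⟩
  · have hdT : Tendsto (fun k => d k - T k) atTop (𝓝 (⨅ k, d k)) := by simpa using hd.sub hT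
    obtain ⟨k, hk⟩ := (hdT.eventually (lt_mem_nhds hc)).exists
    filter_upwards [(hlow' k).eventually (lt_mem_nhds hk)] with N hN
    exact hN.trans_le (hlow k N)
  · obtain ⟨k, hk⟩ := (hd.eventually (gt_mem_nhds hc)).exists
    filter_upwards [(hB k).eventually (gt_mem_nhds hk)] with N hN
    exact (hup k N).trans_lt hN

end HasAsymptoticDensity

/-! ### Contribution of the large primes -/

open Filter Topology in
theorem tendsto_primeCounting_div_atTop :
    Tendsto (fun N : ℕ => (N.primeCounting : ℝ) / N) atTop (𝓝 0) := by
  have h1 : Tendsto (fun N : ℕ => (Real.log 4 + 1) / Real.log N) atTop (𝓝 0) :=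
    (Real.tendsto_log_atTop.comp tendsto_natCast_atTop_atTop).const_div_atTop _
  refine squeeze_zero' (Eventually.of_forall fun _ => by positivity) ?_ h1
  filter_upwards [tendsto_natCast_atTop_atTop.eventually
    (Chebyshev.eventually_primeCounting_le one_pos), eventually_gt_atTop 0] with N hN h0
  have h0' : (0 : ℝ) < N := by exact_mod_cast h0
  rw [Nat.floor_natCast] at hN
  rw [div_le_iff₀ h0']
  refine hN.trans_eq ?_
  ring

/-- `T` bounds every partial sum of `1 / (p * (p - 1))` over the primes `p > k`. -/
def PrimeTailLE (k : ℕ) (T : ℝ) : Prop :=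
  ∀ N : ℕ, ∑ p ∈ (Finset.Ioc k N).filter Nat.Prime, 1 / ((p : ℝ) * (p - 1)) ≤ T

/-- The sum over all integers telescopes. -/
theorem primeTailLE_one_div {k : ℕ} (hk : 0 < k) : PrimeTailLE k (1 / k) := by
  have hk' : (0 : ℝ) < k := by exact_mod_cast hk
  intro N
  rcases le_total N k with h | h
  · rw [Finset.Ioc_eq_empty_of_le h]
    simp
  · suffices H : ∑ p ∈ Finset.Ioc k N, 1 / ((p : ℝ) * (p - 1)) = 1 / k - 1 / N by
      refine (Finset.sum_le_sum_of_subset_of_nonneg (Finset.filter_subset _ _) ?_).trans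
        (H.trans_le (sub_le_self _ (by positivity)))
      intro p hp _
      have : (1 : ℝ) ≤ p := by exact_mod_cast Nat.one_le_of_lt (Finset.mem_Ioc.1 hp).1
      exact div_nonneg zero_le_one (mul_nonneg (by linarith) (by linarith))
    induction N, h using Nat.le_induction with
    | base => simp
    | succ N hN ih =>
      have : (0 : ℝ) < N := by exact_mod_cast hk.trans_le hN
      rw [← Finset.insert_Ioc_right_eq_Ioc_add_one (by omega), Finset.sum_insert (by simp), ih]
      rw [Nat.cast_add_one, add_sub_cancel_right]
      field_simp
      ring

theorem PrimeTailLE.pred {k : ℕ} {T c : ℝ} (hT : PrimeTailLE (k + 1) T) (hc : 0 ≤ c)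
    (h : (k + 1).Prime → 1 / (((k : ℝ) + 1) * k) ≤ c) : PrimeTailLE k (T + c) := by
  intro N
  rcases le_or_gt N k with hN | hN
  · rw [Finset.Ioc_eq_empty_of_le hN]
    -- The empty sum yields `0 ≤ T`.
    have := hT 0
    simp at this
    simpa using add_nonneg this hc
  · rw [← Finset.insert_Ioc_add_one_left_eq_Ioc hN, Finset.filter_insert]
    split_ifs with hp
    · rw [Finset.sum_insert (by simp), add_comm]
      refine add_le_add (hT N) (le_trans (le_of_eq ?_) (h hp))
      push_cast
      ring
    · linarith [hT N]

/-- The positive members of the progression of `p` are `p + p * (p - 1) * j`. Those with `j = 0` are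
primes, counted by `π(N)`; those with `j ≥ 1` number at most `N / (p * (p - 1))`. -/
theorem ncard_primeProgressions_le (k N : ℕ) {T : ℝ} (hT : PrimeTailLE k T) :
    (({n | ∃ p : ℕ, p.Prime ∧ k < p ∧ n ∈ unitProgression (p - 1) p} ∩ Set.Icc 1 N).ncard : ℝ) ≤
      N.primeCounting + N * T := by
  set s := (Finset.Ioc k N).filter Nat.Prime
  have hsub : {n | ∃ p : ℕ, p.Prime ∧ k < p ∧ n ∈ unitProgression (p - 1) p} ∩ Set.Icc 1 N ⊆
      ((Nat.primesLE N ∪ s.biUnion fun p =>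
        (Finset.Icc 1 (N / (p * (p - 1)))).image fun j => p + p * (p - 1) * j : Finset ℕ) : Set ℕ) := by
    rintro n ⟨⟨p, hp, hkp, h1, m, rfl⟩, hn1, hnN⟩
    have hp1 := hp.one_lt
    have hm0 : 0 < m := Nat.pos_of_ne_zero (by rintro rfl; simp at hn1)
    have hm : m ≡ 1 [MOD p - 1] := by
      have : p * m ≡ 1 * m [MOD p - 1] :=
        Nat.ModEq.mul_right m ((Nat.modEq_iff_dvd' hp1.le).2 dvd_rfl).symm
      rw [one_mul] at this
      exact this.symm.trans h1
    obtain ⟨j, hj⟩ := (Nat.modEq_iff_dvd' hm0).1 hm.symm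
    obtain rfl : m = 1 + (p - 1) * j := by omega
    have e : p * (1 + (p - 1) * j) = p + p * (p - 1) * j := by ring
    rw [e] at hnN ⊢
    have hpN : p ≤ N := le_trans (Nat.le_add_right _ _) hnN
    simp only [Finset.coe_union, Set.mem_union, Finset.mem_coe]
    rcases Nat.eq_zero_or_pos j with rfl | hj0
    · left
      simpa [Nat.mem_primesLE] using ⟨hpN, hp⟩
    · right
      simp only [Finset.mem_biUnion, Finset.mem_image, Finset.mem_Icc, s, Finset.mem_filter,
        Finset.mem_Ioc]
      refine ⟨p, ⟨⟨hkp, hpN⟩, hp⟩, j, ⟨hj0, ?_⟩, rfl⟩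
      rw [Nat.le_div_iff_mul_le (Nat.mul_pos hp.pos (by omega)), mul_comm]
      omega
  have h1 := Set.ncard_le_ncard hsub (Finset.finite_toSet _)
  rw [Set.ncard_coe_finset] at h1
  have h2 := h1.trans ((Finset.card_union_le _ _).trans (Nat.add_le_add_left
    (Finset.card_biUnion_le.trans (Finset.sum_le_sum fun p _ => Finset.card_image_le)) _))
  simp only [Nat.card_Icc, Nat.add_sub_cancel, Nat.primesLE_card_eq_primeCounting] at h2
  have h3 : ((∑ p ∈ s, N / (p * (p - 1)) : ℕ) : ℝ) ≤ N * T := by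
    rw [Nat.cast_sum]
    refine le_trans ?_ (mul_le_mul_of_nonneg_left (hT N) (Nat.cast_nonneg N))
    rw [Finset.mul_sum]
    refine Finset.sum_le_sum fun p hp => ?_
    refine Nat.cast_div_le.trans (le_of_eq ?_)
    rw [Nat.cast_mul, Nat.cast_sub (Finset.mem_filter.1 hp).2.one_lt.le, Nat.cast_one,
      mul_one_div]
  refine (Nat.cast_le.2 h2).trans ?_
  rw [Nat.cast_add]
  exact add_le_add_right h3 _

/-! ### The sifted sets and their densities -/

/-- The odd primes up to `k`, in decreasing order. -/
def oddPrimesLE (k : ℕ) : List ℕ :=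
  (List.range (k + 1)).reverse.filter fun p => p.Prime ∧ p ≠ 2

theorem mem_oddPrimesLE {k p : ℕ} : p ∈ oddPrimesLE k ↔ p ≤ k ∧ p.Prime ∧ p ≠ 2 := by
  simp [oddPrimesLE]

theorem one_lt_of_mem_oddPrimesLE {k p : ℕ} (h : p ∈ oddPrimesLE k) : 1 < p :=
  (mem_oddPrimesLE.1 h).2.1.one_lt

theorem odd_of_mem_oddPrimesLE {k p : ℕ} (h : p ∈ oddPrimesLE k) : Odd p :=
  (mem_oddPrimesLE.1 h).2.1.odd_of_ne_two (mem_oddPrimesLE.1 h).2.2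

/-- The odd `n` such that `s * (p - 1) ∤ n - 1` for every prime divisor `p` of `n`. -/
def oddSifted (s : ℕ) : Set ℕ :=
  {n | Odd n ∧ ∀ p : ℕ, p.Prime → p ∣ n → ¬ s * (p - 1) ∣ n - 1}

/-- The superset of `oddSifted s` given by the conditions at the odd primes `p ≤ k`. -/
def oddSiftedLE (s k : ℕ) : Set ℕ :=
  unitProgression 2 1 \ {n | ∃ p ∈ oddPrimesLE k, n ∈ unitProgression (s * (p - 1)) p}

theorem mem_unitProgression_iff {L Q n : ℕ} (hn : 0 < n) :
    n ∈ unitProgression L Q ↔ L ∣ n - 1 ∧ Q ∣ n :=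
  and_congr_left' (Nat.ModEq.comm.trans (Nat.modEq_iff_dvd' hn))

theorem mem_unitProgression_two_one {n : ℕ} : n ∈ unitProgression 2 1 ↔ Odd n := by
  simp [unitProgression, Nat.odd_iff, Nat.ModEq]

theorem oddSifted_subset (s k : ℕ) : oddSifted s ⊆ oddSiftedLE s k := by
  rintro n ⟨ho, h⟩
  refine ⟨mem_unitProgression_two_one.2 ho, ?_⟩
  rintro ⟨p, hp, hn⟩
  have := (mem_unitProgression_iff ho.pos).1 hn
  exact h p (mem_oddPrimesLE.1 hp).2.1 this.2 this.1

/-- Since `s * (p - 1) ∣ n - 1` implies `p - 1 ∣ n - 1`, one tail estimate serves every `s`. -/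
theorem oddSiftedLE_sdiff_subset (s k : ℕ) :
    oddSiftedLE s k \ oddSifted s ⊆
      {n | ∃ p : ℕ, p.Prime ∧ k < p ∧ n ∈ unitProgression (p - 1) p} := by
  rintro n ⟨⟨ho, h⟩, hn⟩
  rw [mem_unitProgression_two_one] at ho
  simp only [oddSifted, Set.mem_ofPred_eq, ho, true_and, not_forall, not_not] at hn
  obtain ⟨p, hp, hpn, hd⟩ := hn
  have hp2 : p ≠ 2 := by
    rintro rfl
    exact Nat.not_even_iff_odd.2 ho (even_iff_two_dvd.2 hpn)
  refine ⟨p, hp, ?_, (mem_unitProgression_iff ho.pos).2 ⟨dvd_of_mul_left_dvd hd, hpn⟩⟩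
  by_contra hk
  exact h ⟨p, mem_oddPrimesLE.2 ⟨not_lt.1 hk, hp, hp2⟩,
    (mem_unitProgression_iff ho.pos).2 ⟨hd, hpn⟩⟩

theorem ncard_oddSiftedLE_sdiff_div_le (s : ℕ) {k : ℕ} {T : ℝ} (hT : PrimeTailLE k T) (N : ℕ) :
    (((oddSiftedLE s k \ oddSifted s) ∩ Set.Icc 1 N).ncard : ℝ) / N ≤
      T + (N.primeCounting : ℝ) / N := by
  rcases Nat.eq_zero_or_pos N with rfl | hN
  · have := hT 0
    simp at this
    simpa using this
  have hN' : (0 : ℝ) < N := by exact_mod_cast hN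
  rw [div_le_iff₀ hN', add_mul, div_mul_cancel₀ _ hN'.ne', add_comm, mul_comm T]
  refine le_trans ?_ (ncard_primeProgressions_le k N hT)
  exact_mod_cast Set.ncard_le_ncard (Set.inter_subset_inter_left _ (oddSiftedLE_sdiff_subset s k))
    (Set.toFinite _)

theorem hasAsymptoticDensity_oddSiftedLE {s L : ℕ} (h : s * L = 2) (k : ℕ) :
    HasAsymptoticDensity (oddSiftedLE s k) (sieveDensity (oddPrimesLE k) L 1 / s) := by
  have hs : 0 < s := Nat.pos_of_ne_zero (by rintro rfl; simp at h)
  have hL : 0 < L := Nat.pos_of_ne_zero (by rintro rfl; simp at h)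
  have := hasAsymptoticDensity_sieve hs (oddPrimesLE k) (fun p hp => ⟨one_lt_of_mem_oddPrimesLE hp,
    (Nat.coprime_two_left.2 (odd_of_mem_oddPrimesLE hp)).coprime_dvd_left ⟨L, h.symm⟩⟩)
    hL one_pos (Nat.coprime_one_right s)
  rwa [h] at this

open Filter Topology in
theorem exists_hasAsymptoticDensity_oddSifted {s L : ℕ} (h : s * L = 2) :
    ∃ D, HasAsymptoticDensity (oddSifted s) D ∧
      Tendsto (fun k => sieveDensity (oddPrimesLE (k + 1)) L 1 / s) atTop (𝓝 D) :=
  HasAsymptoticDensity.exists_of_approx (fun k => hasAsymptoticDensity_oddSiftedLE h (k + 1))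
    (fun k => oddSifted_subset s (k + 1)) tendsto_primeCounting_div_atTop
    ((tendsto_add_atTop_iff_nat 1).2 tendsto_one_div_atTop_nhds_zero_nat)
    fun k N => ncard_oddSiftedLE_sdiff_div_le s (primeTailLE_one_div k.succ_pos) N

theorem setOf_isAntiKorselt_eq_oddSifted : {n : ℕ | IsAntiKorselt n} = oddSifted 1 := by
  ext n
  simp only [oddSifted, one_mul, Set.mem_ofPred_eq]
  exact ⟨fun h => ⟨h.odd, h.2⟩, fun h => ⟨h.1.pos, h.2⟩⟩

theorem oddHalfPowerSumDivisors_eq_oddSifted : oddHalfPowerSumDivisors = oddSifted 2 :=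
  Set.ext fun _ => mem_oddHalfPowerSumDivisors_iff

/-! ### Numerical bounds -/

/-- Bounds for `sieveDensity l L Q` in units of `1 / S`: an upper bound for `u = true`, a lower
bound for `u = false`. Branches of the inclusion-exclusion with `C < L * Q` are estimated
trivially. -/
def sieveBound (S C : ℕ) : List ℕ → Bool → ℕ → ℕ → ℕ
  | [], u, L, Q => if Nat.gcd L Q = 1 then S / (L * Q) + (bif u then 1 else 0) else 0
  | p :: l, u, L, Q =>
    if Nat.gcd L Q = 1 then
      if C < L * Q then bif u then S / (L * Q) + 1 else 0
      else sieveBound S C l u L Q - sieveBound S C l (!u) (L.lcm (p - 1)) (Q.lcm p)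
    else 0

theorem sieveBound_spec (S C : ℕ) {l : List ℕ} (hl : ∀ p ∈ l, 1 < p) {L Q : ℕ} (hL : 0 < L)
    (hQ : 0 < Q) :
    (sieveBound S C l false L Q : ℝ) ≤ S * sieveDensity l L Q ∧
      S * sieveDensity l L Q ≤ sieveBound S C l true L Q := by
  have hS : (0 : ℝ) ≤ S := Nat.cast_nonneg S
  have hlow : ∀ a b : ℕ, ((S / (a * b) : ℕ) : ℝ) ≤ S * (1 / (a * b)) := fun a b => by
    rw [mul_one_div, ← Nat.cast_mul]
    exact Nat.cast_div_le
  have hup : ∀ a b : ℕ, (S : ℝ) * (1 / (a * b)) ≤ (S / (a * b) + 1 : ℕ) := fun a b => by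
    rw [mul_one_div, ← Nat.cast_mul, ← Nat.floor_div_eq_div (K := ℝ), Nat.cast_add_one]
    exact (Nat.lt_floor_add_one _).le
  induction l generalizing L Q with
  | nil =>
    rw [sieveBound, sieveBound, sieveDensity]
    by_cases h : L.Coprime Q
    · rw [if_pos h, if_pos h, if_pos h]
      exact ⟨hlow L Q, hup L Q⟩
    · rw [if_neg h, if_neg h, if_neg h]
      simp
  | cons p l ih =>
    have h0 := sieveDensity_nonneg hl hL hQ
    have h1 := sieveDensity_le hl hL hQ
    rw [sieveBound, sieveBound]
    by_cases h : L.Coprime Q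
    · rw [if_pos h] at h1
      rw [if_pos h, if_pos h]
      split_ifs with hC
      · exact ⟨by simpa using mul_nonneg hS h0, (mul_le_mul_of_nonneg_left h1 hS).trans (hup L Q)⟩
      · have hp := hl p (by simp)
        have hl' : ∀ q ∈ l, 1 < q := fun q hq => hl q (by simp [hq])
        obtain ⟨a1, a2⟩ := ih hl' hL hQ
        obtain ⟨b1, b2⟩ := ih hl' (Nat.lcm_pos hL (by omega : 0 < p - 1))
          (Nat.lcm_pos hQ (by omega : 0 < p))
        have h2 := mul_nonneg hS h0
        rw [sieveDensity, mul_sub] at h2 ⊢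
        rw [Bool.not_true, Bool.not_false]
        constructor
        -- Truncated subtraction is harmless here: the true density is nonnegative.
        · rcases le_total (sieveBound S C l false L Q)
            (sieveBound S C l true (L.lcm (p - 1)) (Q.lcm p)) with hle | hle
          · rwa [Nat.sub_eq_zero_of_le hle, Nat.cast_zero]
          · rw [Nat.cast_sub hle]
            exact sub_le_sub a1 b2
        · refine (sub_le_sub a2 b1).trans ?_
          rw [sub_le_iff_le_add]
          exact_mod_cast le_tsub_add
    · rw [if_neg h] at h1
      rw [if_neg h, if_neg h, le_antisymm h1 h0]
      simp

/-- An upper bound, in units of `1 / S`, for the sum of `1 / (p * (p - 1))` over the primes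
`p ∈ (k, k + 2 ^ j]`, provided that they are coprime to `W`. -/
def primeBlockBound (S W : ℕ) : ℕ → ℕ → ℕ
  | 0, k => if Nat.gcd (k + 1) W = 1 then S / ((k + 1) * k) + 1 else 0
  | j + 1, k => primeBlockBound S W j k + primeBlockBound S W j (k + 2 ^ j)

theorem PrimeTailLE.of_block {S W m : ℕ} (hS : 0 < S) (hW : W ∣ m.factorial) (j : ℕ) {k : ℕ}
    (hk : m ≤ k) (hk0 : 0 < k) {T : ℝ} (hT : PrimeTailLE (k + 2 ^ j) T) :
    PrimeTailLE k (T + (primeBlockBound S W j k : ℝ) / S) := by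
  have hS' : (0 : ℝ) < S := by exact_mod_cast hS
  induction j generalizing k T with
  | zero =>
    refine hT.pred (by positivity) fun hp => ?_
    have hc : Nat.gcd (k + 1) W = 1 := by
      refine (hp.coprime_iff_not_dvd).2 fun h => ?_
      have := hp.dvd_factorial.1 (h.trans hW)
      omega
    rw [primeBlockBound, if_pos hc, le_div_iff₀ hS', one_div_mul_eq_div, ← Nat.cast_add_one,
      ← Nat.cast_mul, ← Nat.floor_div_eq_div (K := ℝ), Nat.cast_add_one]
    exact (Nat.lt_floor_add_one _).le
  | succ j ih =>
    have h1 := ih (k := k + 2 ^ j) (hk.trans (Nat.le_add_right _ _))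
      (Nat.add_pos_left hk0 _) (by rwa [add_assoc, ← two_mul, ← pow_succ'])
    have h2 := ih hk hk0 h1
    rw [primeBlockBound, Nat.cast_add, add_div, add_comm (_ / _ : ℝ), ← add_assoc]
    exact h2

/-- The block is `(250, 4346]`, where `4346 = 250 + 2 ^ 12`, and `10 ^ 12 / 4346 + 1` rounds up the
telescoped tail beyond it. The long constant is the product of the primes up to `61`; as `67 ^ 2 >
4346`, coprimality to it detects exactly the primes of the block. -/
theorem sieveBound_oddPrimesLE_bounds :
    25801 * 10 ^ 7 + 10 ^ 12 / 4346 + 1 + primeBlockBound (10 ^ 12) 117288381359406970983270 12 250 ≤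
      sieveBound (10 ^ 12) (10 ^ 6) (oddPrimesLE 250) false 2 1 ∧
      sieveBound (10 ^ 12) (10 ^ 6) (oddPrimesLE 250) true 2 1 ≤ 259652 * 10 ^ 6 := by
  decide +kernel

theorem mem_Icc_of_hasAsymptoticDensity_oddSifted_one {D : ℝ}
    (hD : HasAsymptoticDensity (oddSifted 1) D) : D ∈ Set.Icc (0.25801 : ℝ) 0.259652 := by
  have hB := hasAsymptoticDensity_oddSiftedLE (one_mul 2) 250
  rw [Nat.cast_one, div_one] at hB
  have hT : PrimeTailLE 250 _ := PrimeTailLE.of_block (S := 10 ^ 12) (m := 61) (by norm_num)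
    (by decide +kernel : 117288381359406970983270 ∣ _) 12 (by norm_num) (by norm_num)
    (primeTailLE_one_div (by norm_num))
  have h1 := hD.sub_le hB (oddSifted_subset 1 250) tendsto_primeCounting_div_atTop
    (ncard_oddSiftedLE_sdiff_div_le 1 hT)
  have h2 := hD.mono hB (oddSifted_subset 1 250)
  obtain ⟨h3, h4⟩ := sieveBound_spec (10 ^ 12) (10 ^ 6) (l := oddPrimesLE 250)
    (fun p hp => one_lt_of_mem_oddPrimesLE hp) (L := 2) (Q := 1) two_pos one_pos
  obtain ⟨h5, h6⟩ := sieveBound_oddPrimesLE_bounds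
  generalize sieveBound _ _ _ false _ _ = a at *
  generalize sieveBound _ _ _ true _ _ = b at *
  generalize primeBlockBound _ _ _ _ = c at *
  have h5' : ((25801 * 10 ^ 7 + 10 ^ 12 / 4346 + 1 + c : ℕ) : ℝ) ≤ a := Nat.cast_le.2 h5
  have h6' : (b : ℝ) ≤ 259652000000 := (Nat.cast_le.2 h6).trans_eq (by norm_num)
  norm_num at h1 h3 h4 h5'
  constructor
  · norm_num
    linarith
  · norm_num
    linarith

theorem mainTheorem8 :
    {n : ℕ | IsAntiKorselt n} =
        powerSumDivisors (fun n => n - 1) \ {n : ℕ | 4 ∣ n} ∧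
      ∃ d : ℝ, HasAsymptoticDensity oddHalfPowerSumDivisors d ∧
        HasAsymptoticDensity {n : ℕ | IsAntiKorselt n} (2 * d - 1 / 2) ∧
        2 * d - 1 / 2 ∈ Set.Icc (0.25801 : ℝ) (0.259652 : ℝ) := by
  obtain ⟨D, hD, hD'⟩ := exists_hasAsymptoticDensity_oddSifted (one_mul 2)
  obtain ⟨d, hd, hd'⟩ := exists_hasAsymptoticDensity_oddSifted (mul_one 2)
  -- The finite-level densities satisfy this relation for each `k`, so their limits do.
  have e : D = 2 * d - 1 / 2 := by
    refine tendsto_nhds_unique hD' (((hd'.const_mul 2).sub_const (1 / 2)).congr fun k => ?_)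
    rw [sieveDensity_two_one fun p hp => odd_of_mem_oddPrimesLE hp]
    push_cast
    ring
  subst e
  refine ⟨setOf_isAntiKorselt_eq, d, ?_, ?_, mem_Icc_of_hasAsymptoticDensity_oddSifted_one hD⟩
  · rwa [oddHalfPowerSumDivisors_eq_oddSifted]
  · rwa [setOf_isAntiKorselt_eq_oddSifted]
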